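/- All rings are commutative with identity. An $R$-module is *of rank $n$* if it is finitely generated, projective, and locally free of constant rank $n$; an $R$-algebra is of rank $n$ if it is so as an $R$-module. For an $R$-algebra $A$ of rank $n$ and $a\in A$, let $P_a(X)\in R[X]$ be the characteristic polynomial of multiplication by $a$ on $A$. For a finite set $S$, an *$S$-closure* of $A$ is an $R$-algebra $A^{(S)}$ with $R$-algebra maps $\alpha_s\colon A\to A^{(S)}$ ($s\in S$) such that for all $R\to R'$ and all $a\in A\otimes_R R'$ the polynomial $\prod_{s\in S}\bigl(X-(\alpha_s\otimes\mathrm{Id})(a)\bigr)$ divides $P_a(X)$ in $(A^{(S)}\otimes_R R')[X]$, and which is universal with this property: for every $R$-algebra $B$ with maps $\beta_s\colon A\to B$ ($s\in S$) having the same property, there is a unique $R$-algebra map $\varphi\colon A^{(S)}\to B$ with $\varphi\circ\alpha_s=\beta_s$ for all $s\in S$. For $S=\{1,\dots,k\}$ one writes $A^{(k)}$ and speaks of the $k$-closure. The Galois closure $G(A/R)$ of Bhargava and Satriano, for $A$ of rank $n$, is the quotient of $A^{\otimes n}$ by the ideal generated by the differences of the coefficients of $P_a(X)$ and of $\prod_{j=1}^n(X-\varepsilon_j(a))$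 for all $a\in A$, where $\varepsilon_j\colon A\to A^{\otimes n}$ is the $j$-th natural map. **Corollary.** For $i=1,\dots,m$ let $A_i$ be an $R$-algebra of rank $n_i$. Let $A=\prod_{i=1}^m A_i$ and $n=\sum_{i=1}^m n_i$. Then $A$ is an $R$-algebra of rank $n$, the closures $A^{(n)}$ and $A_i^{(n_i)}$ exist, and there is an isomorphism of $R$-algebras $$A^{(n)}\;\cong\;\Bigl(\bigotimes_{i=1}^m A_i^{(n_i)}\Bigr)^{\frac{n!}{n_1!\cdots n_m!}}$$ (a product of $n!/(n_1!\cdots n_m!)$ copies, the tensor product being over $R$). Likewise, for the Galois closures of Bhargava and Satriano, $$G(A/R)\;\cong\;\Bigl(\bigotimes_{i=1}^m G(A_i/R)\Bigr)^{\frac{n!}{n_1!\cdots n_m!}}.$$ -/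

import Mathlib

open scoped TensorProduct Polynomial

universe u

/-- A finite product of projective modules is projective. -/
instance instProjectiveFinitePi {R : Type*} [CommRing R] {ι : Type*} [Finite ι]
    (M : ι → Type*) [∀ i, AddCommGroup (M i)] [∀ i, Module R (M i)]
    [∀ i, Module.Projective R (M i)] : Module.Projective R (∀ i, M i) := by
  classical
  have := Fintype.ofFinite ι
  exact Module.Projective.of_equiv (DFinsupp.linearEquivFunOnFintype (R := R) (M := M))

/-- `M` has constant rank `n`: its localization at every prime of `R` has rank `n`.
For `M` finitely generated and projective this says that `M` is locally free of constant
rank `n`, i.e. an `R`-module of rank `n`. -/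
def HasConstantRank (R M : Type*) [CommRing R] [AddCommGroup M] [Module R M] (n : ℕ) : Prop :=
  ∀ p : PrimeSpectrum R, Module.rankAtStalk (R := R) M p = n

section Determinant

variable {R M : Type*} [CommRing R] [AddCommGroup M] [Module R M]

/-- The determinant of `id + s ∘ (g - id) ∘ π` on `R ^ k`. When `π ∘ s = id`, so that
`R ^ k = s(M) ⊕ ker π`, this is the determinant of `g ⊕ id`. -/
noncomputable def detVia (g : M →ₗ[R] M) {k : ℕ} (π : (Fin k → R) →ₗ[R] M)
    (s : M →ₗ[R] (Fin k → R)) : R :=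
  LinearMap.det (LinearMap.id + s ∘ₗ (g - LinearMap.id) ∘ₗ π)

theorem det_id_add_comp_comm {k l : ℕ} (f : (Fin l → R) →ₗ[R] (Fin k → R))
    (h : (Fin k → R) →ₗ[R] (Fin l → R)) :
    LinearMap.det (LinearMap.id + f ∘ₗ h) = LinearMap.det (LinearMap.id + h ∘ₗ f) := by
  rw [← LinearMap.det_toMatrix', ← LinearMap.det_toMatrix', map_add, map_add,
    LinearMap.toMatrix'_id, LinearMap.toMatrix'_id, LinearMap.toMatrix'_comp,
    LinearMap.toMatrix'_comp, Matrix.det_one_add_mul_comm]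

/-- `detVia` does not depend on the presentation of `M` as a direct summand of `R ^ k`. -/
theorem detVia_eq (g : M →ₗ[R] M) {k l : ℕ}
    (π : (Fin k → R) →ₗ[R] M) (s : M →ₗ[R] (Fin k → R)) (h : π ∘ₗ s = LinearMap.id)
    (π' : (Fin l → R) →ₗ[R] M) (s' : M →ₗ[R] (Fin l → R)) (h' : π' ∘ₗ s' = LinearMap.id) :
    detVia g π s = detVia g π' s' := by
  have e1 : s ∘ₗ (g - LinearMap.id) ∘ₗ π
      = (s ∘ₗ π') ∘ₗ (s' ∘ₗ (g - LinearMap.id) ∘ₗ π) := by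
    have e (y : M) : π' (s' y) = y := LinearMap.congr_fun h' y
    refine LinearMap.ext fun x => ?_
    simp only [LinearMap.comp_apply, e]
  have e2 : (s' ∘ₗ (g - LinearMap.id) ∘ₗ π) ∘ₗ (s ∘ₗ π')
      = s' ∘ₗ (g - LinearMap.id) ∘ₗ π' := by
    have e (y : M) : π (s y) = y := LinearMap.congr_fun h y
    refine LinearMap.ext fun x => ?_
    simp only [LinearMap.comp_apply, e]
  rw [detVia, detVia, e1, det_id_add_comp_comm, e2]

/-- The determinant of an endomorphism `g` of a finitely generated projective module `M`: the
determinant of `g ⊕ id` on `M ⊕ Q`, where `M ⊕ Q` is free of finite rank. -/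
noncomputable def projDet [Module.Finite R M] [Module.Projective R M] (g : M →ₗ[R] M) : R :=
  detVia g (Module.Finite.exists_comp_eq_id_of_projective R M).choose_spec.choose
    (Module.Finite.exists_comp_eq_id_of_projective R M).choose_spec.choose_spec.choose

theorem projDet_eq_detVia [Module.Finite R M] [Module.Projective R M] (g : M →ₗ[R] M) {k : ℕ}
    (π : (Fin k → R) →ₗ[R] M) (s : M →ₗ[R] (Fin k → R)) (h : π ∘ₗ s = LinearMap.id) :
    projDet g = detVia g π s :=
  detVia_eq g _ _
    (Module.Finite.exists_comp_eq_id_of_projective R M).choose_spec.choose_spec.choose_spec.2.2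
    π s h

/-- On a finite free module, `projDet` is the usual determinant. -/
theorem projDet_eq_det [Module.Finite R M] [Module.Free R M] (g : M →ₗ[R] M) :
    projDet g = LinearMap.det g := by
  nontriviality R
  have e : M ≃ₗ[R] (Fin (Module.finrank R M) → R) := (Module.finBasis R M).equivFun
  rw [projDet_eq_detVia g e.symm.toLinearMap e.toLinearMap (by ext x; simp), detVia,
    ← LinearMap.det_conj g e]
  congr 1
  ext x : 2
  simp

end Determinant

/-- The characteristic polynomial of an endomorphism `f` of a finitely generated projective
module `M`: the determinant of `X ⊗ id - id ⊗ f` on `R[X] ⊗ M`. -/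
noncomputable def projCharpoly {R M : Type*} [CommRing R] [AddCommGroup M] [Module R M]
    [Module.Finite R M] [Module.Projective R M] (f : M →ₗ[R] M) : R[X] :=
  projDet ((Polynomial.X : R[X]) • LinearMap.id - f.baseChange R[X])

/-- On a finite free module, `projCharpoly` is the usual characteristic polynomial. -/
theorem projCharpoly_eq_charpoly {R M : Type*} [CommRing R] [AddCommGroup M] [Module R M]
    [Module.Finite R M] [Module.Free R M] (f : M →ₗ[R] M) : projCharpoly f = f.charpoly := by
  classical
  nontriviality R
  rw [projCharpoly, projDet_eq_det, LinearMap.charpoly_def,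
    ← LinearMap.det_toMatrix ((Module.Free.chooseBasis R M).baseChange R[X]), Matrix.charpoly]
  congr 1
  ext i j : 1
  simp [LinearMap.toMatrix_apply, Matrix.charmatrix, Matrix.diagonal_apply,
    Finsupp.single_apply, eq_comm, Polynomial.smul_eq_C_mul]

/-- The characteristic polynomial of an element `a` of a finite projective algebra `A`, i.e.
that of the multiplication by `a`. -/
noncomputable def elemCharpoly (R : Type*) {A : Type*} [CommRing R] [CommRing A] [Algebra R A]
    [Module.Finite R A] [Module.Projective R A] (a : A) : R[X] :=
  projCharpoly (LinearMap.mulLeft R a)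

section Closure

variable (R : Type u) (S : Type) [Fintype S] (A : Type u) [CommRing R] [CommRing A]
  [Algebra R A] [Module.Finite R A] [Module.Projective R A]

/-- For all `R → R'` and all `a` in the base change of `A` to `R'`, the polynomial
`∏ s, (X - β_s(a))` divides the characteristic polynomial of `a` over the base change of `B`. -/
def DividesCharpoly (B : Type u) [CommRing B] [Algebra R B] (β : S → A →ₐ[R] B) : Prop :=
  ∀ (R' : Type u) [CommRing R'] [Algebra R R'] (a : R' ⊗[R] A),
    (∏ s, (Polynomial.X - Polynomial.C (Algebra.TensorProduct.map (AlgHom.id R R') (β s) a)) :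
      (R' ⊗[R] B)[X]) ∣ (elemCharpoly R' a).map (algebraMap R' (R' ⊗[R] B))

/-- `(C, α)` is an `S`-closure of the `R`-algebra `A`: it is universal among the `R`-algebras `B`
with maps `β_s : A → B`, `s ∈ S`, such that `DividesCharpoly` holds. -/
structure IsSClosure (C : Type u) [CommRing C] [Algebra R C] (α : S → A →ₐ[R] C) : Prop where
  divides : DividesCharpoly R S A C α
  universal : ∀ (B : Type u) [CommRing B] [Algebra R B] (β : S → A →ₐ[R] B),
    DividesCharpoly R S A B β → ∃! φ : C →ₐ[R] B, ∀ s, φ.comp (α s) = β s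

/-- `A` has an `S`-closure. -/
def ExistsSClosure : Prop :=
  ∃ (C : Type u) (_ : CommRing C) (_ : Algebra R C) (α : S → A →ₐ[R] C), IsSClosure R S A C α

end Closure

section BhargavaSatriano

variable (R A : Type u) [CommRing R] [CommRing A] [Algebra R A] [Module.Finite R A]
  [Module.Projective R A] (n : ℕ)

/-- The ideal of the `n`-th tensor power of `A` generated by the differences of the coefficients
of the characteristic polynomial of `a` and of `∏ j, (X - ε_j(a))`, for `a ∈ A`; here
`ε_j(a) = 1 ⊗ ⋯ ⊗ a ⊗ ⋯ ⊗ 1` with `a` at the place `j`. -/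
noncomputable def galoisClosureIdeal : Ideal (⨂[R] _ : Fin n, A) :=
  Ideal.span {x | ∃ (a : A) (k : ℕ), x =
    ((elemCharpoly R a).map (algebraMap R (⨂[R] _ : Fin n, A))).coeff k -
    (∏ j : Fin n, (Polynomial.X - Polynomial.C
      (PiTensorProduct.singleAlgHom (R := R) (A := fun _ : Fin n => A) j a))).coeff k}

/-- The Galois closure `G(A/R)` of Bhargava and Satriano of an `R`-algebra `A` of rank `n`. -/
abbrev GaloisClosure : Type u := (⨂[R] _ : Fin n, A) ⧸ galoisClosureIdeal R A n

end BhargavaSatriano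

-- Both closures are instances of one universal property. For $A$ of rank $n=|S|$ the polynomials
-- $\prod_s(X-\beta_s(a))$ and $P_a$ are monic of the same degree, so divisibility means equality.
-- Every element of $R'\otimes A$ is the image of one of $R[X_0,X_1,\dots]\otimes A$, so this single
-- base ring tests all $R'$ (`dividesCharpoly_iff`). Thus the $S$-closure is
-- `IsUniversalFactorization` over `MvPolynomial ℕ R`, and the Bhargava–Satriano closure is the same
-- notion over $R$ itself. The product formula is proved once, for any $R'$ with a retraction $R'\to
-- R$.
--
-- Let $e_i\in A=\prod A_i$ be the idempotent of $A_i$, and let $\alpha_s\colon A\to B$ factor the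
-- characteristic polynomials. Expanding $\prod_s\sum_i\alpha_s(e_i)=1$ splits $B$ into a product of
-- rings $B_f$, one for each $f\colon S\to\{1,\dots,m\}$, such that $\alpha_s(e_{f(s)})=1$ in $B_f$.
-- There $\alpha_s$ factors through $A_{f(s)}$. Since $P_{e_i}=(X-1)^{n_i}X^{n-n_i}$, the ring $B_f$
-- vanishes unless each fiber $f^{-1}(i)$ has $n_i$ elements (`FactorsCharpoly.card_fiber`).
--
-- Characteristic polynomials multiply over the factors (`elemCharpoly_pi`), so for such $f$ a
-- factorization for $A$ is the same as one for each $A_i$, by the maps with $s\in f^{-1}(i)$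
-- (`FactorsCharpoly.assemble`, `FactorsCharpoly.of_assemble`). Hence the universal ring for fixed
-- $f$ is the tensor product of those of the $A_i$ (`existsUnique_of_map_single`). The admissible
-- $f$ are counted by the multinomial coefficient (`FiberType.card`).

universe v

/-! ### Dual bases, and the characteristic polynomial as an explicit determinant. -/

section DualBasis

variable {R M : Type*} [CommRing R] [AddCommGroup M] [Module R M]

/-- A finitely generated projective module has a finite dual basis. -/
theorem exists_dual_basis (R M : Type*) [CommRing R] [AddCommGroup M] [Module R M]
    [Module.Finite R M] [Module.Projective R M] :
    ∃ (k : ℕ) (x : Fin k → M) (l : Fin k → M →ₗ[R] R), ∀ m, ∑ i, l i m • x i = m := by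
  obtain ⟨k, π, s, -, -, h⟩ := Module.Finite.exists_comp_eq_id_of_projective R M
  refine ⟨k, fun i => π (Pi.single i 1), fun i => LinearMap.proj i ∘ₗ s, fun m => ?_⟩
  have h1 : π (s m) = m := LinearMap.congr_fun h m
  conv_rhs => rw [← h1, LinearMap.pi_apply_eq_sum_univ π (s m)]
  refine Finset.sum_congr rfl fun i _ => ?_
  simp only [LinearMap.comp_apply, LinearMap.proj_apply]
  congr 2
  ext j
  simp [Pi.single_apply, eq_comm]

/-- The extension of scalars of a linear functional. -/
noncomputable def extendFunctional (R' : Type*) [CommRing R'] [Algebra R R'] (l : M →ₗ[R] R) :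
    R' ⊗[R] M →ₗ[R'] R' :=
  (TensorProduct.AlgebraTensorModule.rid R R' R').toLinearMap ∘ₗ l.baseChange R'

@[simp]
theorem extendFunctional_tmul (R' : Type*) [CommRing R'] [Algebra R R'] (l : M →ₗ[R] R)
    (r : R') (m : M) : extendFunctional R' l (r ⊗ₜ m) = l m • r := by
  simp [extendFunctional]

variable {ι : Type*} [Fintype ι] [DecidableEq ι]

omit [DecidableEq ι] in
theorem extendFunctional_dual_basis (R' : Type*) [CommRing R'] [Algebra R R'] {x : ι → M}
    {l : ι → M →ₗ[R] R} (h : ∀ m, ∑ i, l i m • x i = m) (m : R' ⊗[R] M) :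
    ∑ i, extendFunctional R' (l i) m • ((1 : R') ⊗ₜ[R] x i) = m := by
  induction m with
  | zero => simp
  | add a b ha hb => simp only [map_add, add_smul, Finset.sum_add_distrib, ha, hb]
  | tmul r m =>
    conv_rhs => rw [← h m, TensorProduct.tmul_sum]
    refine Finset.sum_congr rfl fun i _ => ?_
    rw [extendFunctional_tmul, TensorProduct.smul_tmul', smul_assoc, smul_eq_mul, mul_one,
      TensorProduct.smul_tmul]

/-- A dual basis presents $M$ as a summand of a free module: the $x_i$ give the projection and the
$l_i$ the section. The matrix is that of $\mathrm{id}+s(g-\mathrm{id})\pi$ in the standard basis. -/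
theorem projDet_eq_det_of_dual_basis [Module.Finite R M] [Module.Projective R M] (g : M →ₗ[R] M)
    {x : ι → M} {l : ι → M →ₗ[R] R} (h : ∀ m, ∑ i, l i m • x i = m) :
    projDet g = (1 + Matrix.of fun i j => l i (g (x j) - x j)).det := by
  let e := Fintype.equivFin ι
  let π : (Fin (Fintype.card ι) → R) →ₗ[R] M := Fintype.linearCombination R (x ∘ e.symm)
  let s : M →ₗ[R] (Fin (Fintype.card ι) → R) := LinearMap.pi fun i => l (e.symm i)
  have hs : π ∘ₗ s = LinearMap.id := by
    ext m
    simp only [π, s, LinearMap.comp_apply, Fintype.linearCombination_apply, LinearMap.pi_apply,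
      LinearMap.id_apply, Function.comp_apply]
    rw [e.symm.sum_comp fun i => l i m • x i, h]
  rw [projDet_eq_detVia g π s hs, detVia, ← LinearMap.det_toMatrix', map_add,
    LinearMap.toMatrix'_id, ← Matrix.det_reindex_self e]
  congr 1
  ext i j
  simp [Matrix.one_apply, LinearMap.toMatrix'_apply, π, s, Fintype.linearCombination_apply_single]

theorem projCharpoly_eq_det_of_dual_basis [Module.Finite R M] [Module.Projective R M]
    (f : M →ₗ[R] M) {x : ι → M} {l : ι → M →ₗ[R] R} (h : ∀ m, ∑ i, l i m • x i = m) :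
    projCharpoly f = (1 + Matrix.of fun i j => (Polynomial.X - 1) * Polynomial.C (l i (x j))
      - Polynomial.C (l i (f (x j)))).det := by
  rw [projCharpoly, projDet_eq_det_of_dual_basis _ (extendFunctional_dual_basis R[X] h)]
  congr 2
  ext1 i j
  simp [TensorProduct.smul_tmul', Polynomial.smul_eq_C_mul]
  ring

theorem elemCharpoly_eq_det {A : Type*} [CommRing A] [Algebra R A] [Module.Finite R A]
    [Module.Projective R A] {x : ι → A} {l : ι → A →ₗ[R] R} (h : ∀ m, ∑ i, l i m • x i = m)
    (a : A) :
    elemCharpoly R a = (1 + Matrix.of fun i j => (Polynomial.X - 1) * Polynomial.C (l i (x j))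
      - Polynomial.C (l i (a * x j))).det := by
  rw [elemCharpoly, projCharpoly_eq_det_of_dual_basis _ h]
  rfl

end DualBasis

theorem Equiv.exists_sigma_fiber {o : Type*} (n : o → Type*) (i : o) :
    ∃ e : n i ≃ {a : Σ i, n i // a.1 = i}, ∀ x, (e x).1 = ⟨i, x⟩ :=
  ⟨Equiv.ofBijective (fun x => ⟨⟨i, x⟩, rfl⟩) ⟨fun x y h => by simpa using h, by
    rintro ⟨⟨j, x⟩, rfl⟩; exact ⟨x, rfl⟩⟩, fun _ => rfl⟩

/-- The order on the index type lets the matrix be treated as block triangular. -/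
theorem Matrix.det_blockDiagonal_sigma {R o : Type*} [CommRing R] [Fintype o] [LinearOrder o]
    {n : o → Type*} [∀ i, Fintype (n i)] [∀ i, DecidableEq (n i)]
    (M : ∀ i, Matrix (n i) (n i) R) : (Matrix.blockDiagonal' M).det = ∏ i, (M i).det := by
  rw [(Matrix.blockTriangular_blockDiagonal' M).det_fintype]
  refine Finset.prod_congr rfl fun i _ => ?_
  obtain ⟨e, he⟩ := Equiv.exists_sigma_fiber n i
  rw [← Matrix.det_submatrix_equiv_self e]
  congr 1
  ext a b
  simp [Matrix.toSquareBlock_def, he]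

/-! ### Base change of characteristic polynomials. -/

section ElemCharpoly

variable {R A : Type*} [CommRing R] [CommRing A] [Algebra R A] [Module.Finite R A]
    [Module.Projective R A]

theorem elemCharpoly_baseChange_eq_det {ι : Type*} [Fintype ι] [DecidableEq ι] {x : ι → A}
    {l : ι → A →ₗ[R] R}
    (h : ∀ m, ∑ i, l i m • x i = m) {R' : Type*} [CommRing R'] [Algebra R R'] (a : R' ⊗[R] A) :
    elemCharpoly R' a = (1 + Matrix.of fun i j => (Polynomial.X - 1) *
      Polynomial.C (algebraMap R R' (l i (x j)))
      - Polynomial.C (extendFunctional R' (l i) (a * 1 ⊗ₜ x j))).det := by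
  rw [elemCharpoly_eq_det (extendFunctional_dual_basis R' h)]
  simp only [extendFunctional_tmul, Algebra.algebraMap_eq_smul_one]

/-- One dual basis of $A$ over $R$ serves over $R_1$ and over $R_2$, so the two determinants
correspond entry by entry. -/
theorem elemCharpoly_map {R₁ R₂ : Type*} [CommRing R₁] [CommRing R₂] [Algebra R R₁] [Algebra R R₂]
    (f : R₁ →ₐ[R] R₂) (a : R₁ ⊗[R] A) :
    (elemCharpoly R₁ a).map (f : R₁ →+* R₂) =
      elemCharpoly R₂ (Algebra.TensorProduct.map f (AlgHom.id R A) a) := by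
  obtain ⟨k, x, l, h⟩ := exists_dual_basis R A
  have key (i : Fin k) (y : R₁ ⊗[R] A) : f (extendFunctional R₁ (l i) y) =
      extendFunctional R₂ (l i) (Algebra.TensorProduct.map f (AlgHom.id R A) y) := by
    induction y with
    | zero => simp
    | add a b ha hb => simp only [map_add, ha, hb]
    | tmul r m => simp
  rw [elemCharpoly_baseChange_eq_det h, elemCharpoly_baseChange_eq_det h,
    ← Polynomial.coe_mapRingHom, RingHom.map_det]
  congr 1
  ext1 i j
  have : f (extendFunctional R₁ (l i) (a * 1 ⊗ₜ[R] x j)) = extendFunctional R₂ (l i)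
     (Algebra.TensorProduct.map f (AlgHom.id R A) a * 1 ⊗ₜ[R] x j) := by
    rw [key, map_mul]
    simp
  simp only [RingHom.mapMatrix_apply, Matrix.map_apply, Matrix.add_apply, Matrix.of_apply,
    Polynomial.coe_mapRingHom, Polynomial.map_add, Polynomial.map_sub, Polynomial.map_mul,
    Polynomial.map_C, Polynomial.map_X, Polynomial.map_one, RingHom.coe_coe, AlgHom.commutes,
    ← this]
  simp [Matrix.one_apply, apply_ite]

theorem elemCharpoly_tmul (R' : Type*) [CommRing R'] [Algebra R R'] (a : A) :
    elemCharpoly R' ((1 : R') ⊗ₜ[R] a) = (elemCharpoly R a).map (algebraMap R R') := by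
  obtain ⟨k, x, l, h⟩ := exists_dual_basis R A
  rw [elemCharpoly_baseChange_eq_det h,
    elemCharpoly_eq_det h, ← Polynomial.coe_mapRingHom, RingHom.map_det]
  congr 1
  ext1 i j
  simp [Matrix.one_apply, apply_ite, Algebra.smul_def]

end ElemCharpoly

/-! ### Characteristic polynomials on a finite product of algebras. -/

section Pi

variable {R : Type*} [CommRing R] {o : Type*} [Fintype o] [LinearOrder o] {A : o → Type*}
  [∀ i, CommRing (A i)] [∀ i, Algebra R (A i)] [∀ i, Module.Finite R (A i)]
  [∀ i, Module.Projective R (A i)]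

/-- The union of dual bases of the $A_i$ is one of the product. In it the matrix is block diagonal,
since a functional on $A_i$ kills the basis vectors of the other factors and their multiples. -/
theorem elemCharpoly_pi {R' : Type*} [CommRing R'] [Algebra R R'] (a : R' ⊗[R] (∀ i, A i)) :
    elemCharpoly R' a = ∏ i, elemCharpoly R'
      (Algebra.TensorProduct.map (AlgHom.id R R') (Pi.evalAlgHom R A i) a) := by
  choose k x l h using fun i => exists_dual_basis R (A i)
  have h' (y : ∀ i, A i) : ∑ p : Σ i, Fin (k i),
      ((l p.1 p.2).comp (LinearMap.proj p.1)) y • Pi.single p.1 (x p.1 p.2) = y := by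
    rw [Fintype.sum_sigma]
    conv_rhs => rw [← Finset.univ_sum_single y]
    refine Finset.sum_congr rfl fun i _ => ?_
    conv_rhs => rw [← h i (y i)]
    simp only [LinearMap.comp_apply, LinearMap.proj_apply]
    rw [← LinearMap.single_apply (R := R), map_sum]
    simp
  have key (p : Σ i, Fin (k i)) (y : R' ⊗[R] (∀ i, A i)) :
      extendFunctional R' ((l p.1 p.2).comp (LinearMap.proj p.1)) y =
      extendFunctional R' (l p.1 p.2)
        (Algebra.TensorProduct.map (AlgHom.id R R') (Pi.evalAlgHom R A p.1) y) := by
    induction y with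
    | zero => simp
    | add a b ha hb => simp only [map_add, ha, hb]
    | tmul r m => simp
  rw [elemCharpoly_baseChange_eq_det h']
  simp_rw [elemCharpoly_baseChange_eq_det (h _)]
  rw [← Matrix.det_blockDiagonal_sigma]
  congr 1
  ext1 ⟨i, p⟩ ⟨j, q⟩
  rw [Matrix.add_apply, Matrix.of_apply, key, map_mul]
  simp only [Algebra.TensorProduct.map_tmul, AlgHom.id_apply, Pi.evalAlgHom_apply,
    LinearMap.comp_apply, LinearMap.proj_apply]
  obtain rfl | hij := eq_or_ne i j
  · simp [Matrix.one_apply]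
  · rw [Matrix.blockDiagonal'_apply_ne _ _ _ hij, Matrix.one_apply_ne (by simp [hij])]
    simp [Pi.single_eq_of_ne hij]

omit [LinearOrder o] in
theorem HasConstantRank.pi {n : o → ℕ} (h : ∀ i, HasConstantRank R (A i) (n i)) :
    HasConstantRank R (∀ i, A i) (∑ i, n i) := fun p => by
  rw [Module.rankAtStalk_pi, finsum_eq_sum_of_fintype]
  exact Finset.sum_congr rfl fun i _ => h i p

end Pi

/-! ### Consequences of constant rank, by localization at primes. -/

section Rank

variable {R : Type u} {A : Type v} [CommRing R] [CommRing A] [Algebra R A] [Module.Finite R A]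
    [Module.Projective R A] {n : ℕ}

theorem HasConstantRank.baseChange (h : HasConstantRank R A n) (R' : Type*) [CommRing R']
    [Algebra R R'] : HasConstantRank R' (R' ⊗[R] A) n := fun p => by
  rw [Module.rankAtStalk_baseChange]
  exact h _

/-- Projective modules over a local ring are free, so here the usual theory of the characteristic
polynomial applies. The multiplication maps are packaged as one ring homomorphism, so that $0$ and
$1$ go to the zero and identity endomorphisms. -/
theorem elemCharpoly_localization (h : HasConstantRank R A n) (J : Ideal R) [J.IsPrime] :
    ∃ (M : Type (max u v)) (_ : AddCommGroup M) (_ : Module (Localization.AtPrime J) M)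
      (_ : Module.Free (Localization.AtPrime J) M) (_ : Module.Finite (Localization.AtPrime J) M)
      (f : A →+* Module.End (Localization.AtPrime J) M),
      Module.finrank (Localization.AtPrime J) M = n ∧ ∀ a : A,
        (elemCharpoly R a).map (algebraMap R (Localization.AtPrime J)) = (f a).charpoly := by
  have : Module.Free (Localization.AtPrime J) (Localization.AtPrime J ⊗[R] A) :=
    Module.free_of_flat_of_isLocalRing
  refine ⟨Localization.AtPrime J ⊗[R] A, _, _, this, inferInstance,
    ((Algebra.lmul (Localization.AtPrime J) (Localization.AtPrime J ⊗[R] A)).toRingHom.comp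
      (Algebra.TensorProduct.includeRight : A →ₐ[R] Localization.AtPrime J ⊗[R] A).toRingHom),
    ?_, fun a => ?_⟩
  · rw [← Module.rankAtStalk_eq_finrank_tensorProduct (R := R) (M := A) ⟨J, ‹_›⟩, h]
  · rw [← elemCharpoly_tmul, elemCharpoly, projCharpoly_eq_charpoly]
    rfl

theorem Polynomial.eq_of_localization {p q : R[X]} (h : ∀ (J : Ideal R) [J.IsPrime],
    p.map (algebraMap R (Localization.AtPrime J)) =
      q.map (algebraMap R (Localization.AtPrime J))) : p = q := by
  ext k
  rw [← sub_eq_zero]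
  refine eq_zero_of_localization _ fun J hJ => ?_
  have := congrArg (fun p => p.coeff k) (h J)
  simpa [sub_eq_zero] using this

theorem elemCharpoly_natDegree_le (h : HasConstantRank R A n) (a : A) :
    (elemCharpoly R a).natDegree ≤ n := by
  rw [Polynomial.natDegree_le_iff_coeff_eq_zero]
  refine fun k hk => eq_zero_of_localization _ fun J hJ => ?_
  obtain ⟨M, _, _, _, _, f, hn, hf⟩ := elemCharpoly_localization h J
  rw [← Polynomial.coeff_map, hf, Polynomial.coeff_eq_zero_of_natDegree_lt]
  rwa [LinearMap.charpoly_natDegree, hn]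

theorem elemCharpoly_monic (h : HasConstantRank R A n) (a : A) :
    (elemCharpoly R a).Monic := by
  refine Polynomial.monic_of_natDegree_le_of_coeff_eq_one n (elemCharpoly_natDegree_le h a) ?_
  rw [← sub_eq_zero]
  refine eq_zero_of_localization _ fun J hJ => ?_
  obtain ⟨M, _, _, _, _, f, hn, hf⟩ := elemCharpoly_localization h J
  rw [map_sub, map_one, ← Polynomial.coeff_map, hf, sub_eq_zero, ← hn,
    ← LinearMap.charpoly_natDegree (f a)]
  exact (f a).charpoly_monic

theorem elemCharpoly_zero (h : HasConstantRank R A n) :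
    elemCharpoly R (0 : A) = Polynomial.X ^ n := by
  refine Polynomial.eq_of_localization fun J hJ => ?_
  obtain ⟨M, _, _, _, _, f, hn, hf⟩ := elemCharpoly_localization h J
  rw [hf, map_zero, LinearMap.charpoly_zero, hn]
  simp

theorem elemCharpoly_one (h : HasConstantRank R A n) :
    elemCharpoly R (1 : A) = (Polynomial.X - 1) ^ n := by
  refine Polynomial.eq_of_localization fun J hJ => ?_
  obtain ⟨M, _, _, _, _, f, hn, hf⟩ := elemCharpoly_localization h J
  rw [hf, map_one, LinearMap.charpoly_one, hn]
  simp

end Rank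

/-! ### From divisibility over all base changes to equality over one. -/

section Factors

variable (R R' : Type u) (S : Type) [Fintype S] (A B : Type u) [CommRing R] [CommRing R']
  [Algebra R R'] [CommRing A] [CommRing B] [Algebra R A] [Algebra R B] [Module.Finite R A]
  [Module.Projective R A]

/-- For all `a` in the base change of `A` to `R'`, the characteristic polynomial of `a` is the
product `∏ s, (X - β_s(a))` over the base change of `B`. -/
def FactorsCharpoly (β : S → A →ₐ[R] B) : Prop :=
  ∀ a : R' ⊗[R] A,
    (∏ s, (Polynomial.X - Polynomial.C (Algebra.TensorProduct.map (AlgHom.id R R') (β s) a)) :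
      (R' ⊗[R] B)[X]) = (elemCharpoly R' a).map (algebraMap R' (R' ⊗[R] B))

variable {R R' S A B}

theorem map_algebraMap_baseChange {B' : Type u} [CommRing B'] [Algebra R B'] (φ : B →ₐ[R] B')
    (p : R'[X]) : (p.map (algebraMap R' (R' ⊗[R] B))).map
      (Algebra.TensorProduct.map (AlgHom.id R R') φ : R' ⊗[R] B →+* R' ⊗[R] B') =
        p.map (algebraMap R' (R' ⊗[R] B')) := by
  rw [Polynomial.map_map]
  congr 1
  ext r
  simp [Algebra.TensorProduct.algebraMap_apply]

omit [Module.Finite R A] [Module.Projective R A] in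
theorem map_prod_baseChange {B' : Type u} [CommRing B'] [Algebra R B'] (φ : B →ₐ[R] B')
    (β : S → A →ₐ[R] B) (a : R' ⊗[R] A) :
    (∏ s, (Polynomial.X - Polynomial.C (Algebra.TensorProduct.map (AlgHom.id R R') (β s) a)) :
      (R' ⊗[R] B)[X]).map
      (Algebra.TensorProduct.map (AlgHom.id R R') φ : R' ⊗[R] B →+* R' ⊗[R] B') =
    ∏ s, (Polynomial.X -
      Polynomial.C (Algebra.TensorProduct.map (AlgHom.id R R') (φ.comp (β s)) a)) := by
  rw [Polynomial.map_prod]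
  refine Finset.prod_congr rfl fun s _ => ?_
  rw [Polynomial.map_sub, Polynomial.map_X, Polynomial.map_C, Algebra.TensorProduct.map_id_comp]
  rfl

theorem FactorsCharpoly.comp {B' : Type u} [CommRing B'] [Algebra R B'] {β : S → A →ₐ[R] B}
    (h : FactorsCharpoly R R' S A B β) (φ : B →ₐ[R] B') :
    FactorsCharpoly R R' S A B' fun s => φ.comp (β s) := fun a => by
  rw [← map_prod_baseChange, h, map_algebraMap_baseChange]


theorem baseChange_pi_ext {F : Type*} [Finite F] {B : F → Type*} [∀ f, CommRing (B f)]
    [∀ f, Algebra R (B f)] {x y : R' ⊗[R] (∀ f, B f)}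
    (h : ∀ f, Algebra.TensorProduct.map (AlgHom.id R R') (Pi.evalAlgHom R B f) x =
      Algebra.TensorProduct.map (AlgHom.id R R') (Pi.evalAlgHom R B f) y) : x = y := by
  classical
  have := Fintype.ofFinite F
  have key (f : F) (x : R' ⊗[R] (∀ f, B f)) : Algebra.TensorProduct.piRight R R R' B x f =
      Algebra.TensorProduct.map (AlgHom.id R R') (Pi.evalAlgHom R B f) x := by
    induction x with
    | zero => simp
    | add a b ha hb => simp only [map_add, Pi.add_apply, ha, hb]
    | tmul r m => simp
  refine (Algebra.TensorProduct.piRight R R R' B).injective (funext fun f => ?_)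
  rw [key, key, h]

/-- Tensoring with $R'$ commutes with finite products, so coefficients can be compared in each
factor. -/
theorem FactorsCharpoly.pi {F : Type} [Finite F] {B : F → Type u} [∀ f, CommRing (B f)]
    [∀ f, Algebra R (B f)] {β : S → A →ₐ[R] ∀ f, B f}
    (h : ∀ f, FactorsCharpoly R R' S A (B f) fun s => (Pi.evalAlgHom R B f).comp (β s)) :
    FactorsCharpoly R R' S A (∀ f, B f) β := fun a => by
  ext k
  refine baseChange_pi_ext fun f => ?_
  have := congrArg (fun p => p.coeff k) (h f a)
  dsimp only at this
  rwa [← map_prod_baseChange, ← map_algebraMap_baseChange (Pi.evalAlgHom R B f),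
    Polynomial.coeff_map, Polynomial.coeff_map] at this

/-- The factorization of the characteristic polynomial is preserved by `R₁ → R₂`. -/
theorem prod_eq_elemCharpoly_map {R₁ R₂ : Type u} [CommRing R₁] [CommRing R₂] [Algebra R R₁]
    [Algebra R R₂] (f : R₁ →ₐ[R] R₂) {β : S → A →ₐ[R] B} {a : R₁ ⊗[R] A}
    (h : (∏ s, (Polynomial.X -
      Polynomial.C (Algebra.TensorProduct.map (AlgHom.id R R₁) (β s) a)) : (R₁ ⊗[R] B)[X]) =
      (elemCharpoly R₁ a).map (algebraMap R₁ (R₁ ⊗[R] B))) :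
    (∏ s, (Polynomial.X - Polynomial.C (Algebra.TensorProduct.map (AlgHom.id R R₂) (β s)
      (Algebra.TensorProduct.map f (AlgHom.id R A) a))) : (R₂ ⊗[R] B)[X]) =
      (elemCharpoly R₂ (Algebra.TensorProduct.map f (AlgHom.id R A) a)).map
        (algebraMap R₂ (R₂ ⊗[R] B)) := by
  have key := congrArg (Polynomial.map
    (Algebra.TensorProduct.map f (AlgHom.id R B) : R₁ ⊗[R] B →+* R₂ ⊗[R] B)) h
  rw [Polynomial.map_prod, Polynomial.map_map] at key
  rw [← elemCharpoly_map, Polynomial.map_map]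
  convert key using 1
  · refine Finset.prod_congr rfl fun s _ => ?_
    rw [Polynomial.map_sub, Polynomial.map_X, Polynomial.map_C]
    congr 2
    simp only [RingHom.coe_coe, ← AlgHom.comp_apply, ← Algebra.TensorProduct.map_comp]
    rfl
  · congr 1

/-- Extend $a$ to $R'$ and push the factorization back along $\pi$, which retracts the structure map
$R\to R'$. -/
theorem FactorsCharpoly.of_algHom {β : S → A →ₐ[R] B} (h : FactorsCharpoly R R' S A B β)
    (π : R' →ₐ[R] R) : FactorsCharpoly R R S A B β := fun a => by
  have : Algebra.TensorProduct.map π (AlgHom.id R A)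
      (Algebra.TensorProduct.map (Algebra.ofId R R') (AlgHom.id R A) a) = a := by
    rw [← AlgHom.comp_apply, ← Algebra.TensorProduct.map_comp, Subsingleton.elim
      (π.comp (Algebra.ofId R R')) (AlgHom.id R R)]
    simp
  rw [← this]
  exact prod_eq_elemCharpoly_map π (h _)

omit [Module.Finite R A] [Module.Projective R A] in
-- Write $a=\sum r_i\otimes a_i$ and replace the $r_i$ by distinct variables. With countably many
-- variables, one ring suffices for sums of any length.
theorem exists_mvPolynomial_map (a : R' ⊗[R] A) : ∃ (f : MvPolynomial ℕ R →ₐ[R] R')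
    (b : MvPolynomial ℕ R ⊗[R] A), Algebra.TensorProduct.map f (AlgHom.id R A) b = a := by
  classical
  obtain ⟨s, rfl⟩ := TensorProduct.exists_finset a
  let e := s.equivFin
  -- The variables of index at least `s.card` do not occur in the chosen element, so their value $0$
  -- is arbitrary.
  refine ⟨MvPolynomial.aeval fun k => if h : k < s.card then (e.symm ⟨k, h⟩).1.1 else 0,
    ∑ i : s, MvPolynomial.X (e i : ℕ) ⊗ₜ i.1.2, ?_⟩
  rw [map_sum, ← Finset.sum_coe_sort s]
  refine Finset.sum_congr rfl fun i _ => ?_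
  simp

theorem FactorsCharpoly.of_mvPolynomial {β : S → A →ₐ[R] B}
    (h : FactorsCharpoly R (MvPolynomial ℕ R) S A B β) : FactorsCharpoly R R' S A B β := fun a => by
  obtain ⟨f, b, rfl⟩ := exists_mvPolynomial_map a
  exact prod_eq_elemCharpoly_map f (h b)

theorem factorsCharpoly_self_iff {β : S → A →ₐ[R] B} : FactorsCharpoly R R S A B β ↔
    ∀ a : A, (∏ s, (Polynomial.X - Polynomial.C (β s a)) : B[X]) =
      (elemCharpoly R a).map (algebraMap R B) := by
  have key (a : A) : ((∏ s, (Polynomial.X -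
      Polynomial.C (Algebra.TensorProduct.map (AlgHom.id R R) (β s) (1 ⊗ₜ a))) : (R ⊗[R] B)[X]) =
        (elemCharpoly R ((1 : R) ⊗ₜ[R] a)).map (algebraMap R (R ⊗[R] B))) ↔
      (∏ s, (Polynomial.X - Polynomial.C (β s a)) : B[X]) =
        (elemCharpoly R a).map (algebraMap R B) := by
    rw [← (Polynomial.map_injective (Algebra.TensorProduct.lid R B : R ⊗[R] B →+* B)
      (Algebra.TensorProduct.lid R B).injective).eq_iff, elemCharpoly_tmul, Algebra.algebraMap_self,
      Polynomial.map_id, Polynomial.map_map, Polynomial.map_prod]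
    have h1 : ((Algebra.TensorProduct.lid R B : R ⊗[R] B →+* B).comp
        (algebraMap R (R ⊗[R] B))) = algebraMap R B := by
      ext r
      simp [Algebra.algebraMap_eq_smul_one]
    rw [h1]
    simp
  refine ⟨fun h a => (key a).1 (h _), fun h a => ?_⟩
  rw [← (Algebra.TensorProduct.lid R A).symm_apply_apply a, Algebra.TensorProduct.lid_symm_apply]
  exact (key _).2 (h _)

/-- A monic polynomial dividing another monic one of no larger degree equals it. Conversely,
equality for the generic elements specializes to every $R'$. -/
theorem dividesCharpoly_iff {n : ℕ} (hA : HasConstantRank R A n) (hS : Fintype.card S = n)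
    {β : S → A →ₐ[R] B} :
    DividesCharpoly R S A B β ↔ FactorsCharpoly R (MvPolynomial ℕ R) S A B β := by
  refine ⟨fun h a => ?_, fun h R' _ _ a => (h.of_mvPolynomial a).dvd⟩
  nontriviality (MvPolynomial ℕ R ⊗[R] B)
  have hb := hA.baseChange (MvPolynomial ℕ R)
  refine (Polynomial.eq_of_monic_of_dvd_of_natDegree_le
    (Polynomial.monic_prod_of_monic _ _ fun s _ => Polynomial.monic_X_sub_C _)
    ((elemCharpoly_monic hb a).map _) (h _ a) ?_).symm
  rw [Polynomial.natDegree_prod_of_monic _ _ fun s _ => Polynomial.monic_X_sub_C _]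
  simpa [hS] using Polynomial.natDegree_map_le.trans (elemCharpoly_natDegree_le hb a)

end Factors

/-! ### Universal factorizations: uniqueness, existence, and the Galois closure. -/

section Universal

theorem Polynomial.map_eq_map_iff_coeff {R S : Type*} [Semiring R] [Semiring S] (f : R →+* S)
    {p q : R[X]} : p.map f = q.map f ↔ ∀ k, f (p.coeff k) = f (q.coeff k) := by
  simp [Polynomial.ext_iff]

theorem PiTensorProduct.exists_algHom_comp_single {R ι B : Type*} [CommRing R] [Fintype ι]
    [DecidableEq ι] {A : ι → Type*} [∀ i, CommRing (A i)] [∀ i, Algebra R (A i)] [CommRing B]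
    [Algebra R B] (β : ∀ i, A i →ₐ[R] B) :
    ∃ φ : (⨂[R] i, A i) →ₐ[R] B, ∀ i, φ.comp (PiTensorProduct.singleAlgHom i) = β i := by
  let f : MultilinearMap R A B :=
    (MultilinearMap.mkPiAlgebra R ι B).compLinearMap fun i => (β i).toLinearMap
  have hf (x : ∀ i, A i) : f x = ∏ i, β i (x i) := by simp [f]
  refine ⟨PiTensorProduct.liftAlgHom f (by simp [hf]) fun x y => by
    simp [hf, Finset.prod_mul_distrib], fun i => ?_⟩
  ext a
  refine (PiTensorProduct.lift.tprod _).trans ?_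
  rw [hf, MonoidHom.mulSingle_apply, Finset.prod_eq_single i
    (fun j _ hj => by rw [Pi.mulSingle_eq_of_ne hj, map_one]) (by simp), Pi.mulSingle_eq_same]

variable (R R' : Type u) (S : Type) [Fintype S] (A C : Type u) [CommRing R] [CommRing R']
  [Algebra R R'] [CommRing A] [CommRing C] [Algebra R A] [Algebra R C] [Module.Finite R A]
  [Module.Projective R A]

/-- `(C, α)` is universal among the `R`-algebras with maps from `A` that factor the
characteristic polynomials of the elements of `R' ⊗ A`. -/
structure IsUniversalFactorization (α : S → A →ₐ[R] C) : Prop where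
  factors : FactorsCharpoly R R' S A C α
  universal : ∀ (B : Type u) [CommRing B] [Algebra R B] (β : S → A →ₐ[R] B),
    FactorsCharpoly R R' S A B β → ∃! φ : C →ₐ[R] B, ∀ s, φ.comp (α s) = β s

variable {R R' S A C}

theorem isSClosure_iff {n : ℕ} (hA : HasConstantRank R A n) (hS : Fintype.card S = n)
    {α : S → A →ₐ[R] C} :
    IsSClosure R S A C α ↔ IsUniversalFactorization R (MvPolynomial ℕ R) S A C α := by
  constructor
  · rintro ⟨h1, h2⟩
    exact ⟨(dividesCharpoly_iff hA hS).1 h1,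
      fun B _ _ β hβ => h2 B β ((dividesCharpoly_iff hA hS).2 hβ)⟩
  · rintro ⟨h1, h2⟩
    exact ⟨(dividesCharpoly_iff hA hS).2 h1,
      fun B _ _ β hβ => h2 B β ((dividesCharpoly_iff hA hS).1 hβ)⟩

theorem IsUniversalFactorization.nonempty_algEquiv {C' : Type u} [CommRing C'] [Algebra R C']
    {α : S → A →ₐ[R] C} {α' : S → A →ₐ[R] C'} (h : IsUniversalFactorization R R' S A C α)
    (h' : IsUniversalFactorization R R' S A C' α') : Nonempty (C ≃ₐ[R] C') := by
  obtain ⟨φ, hφ, -⟩ := h.universal C' α' h'.factors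
  obtain ⟨ψ, hψ, -⟩ := h'.universal C α h.factors
  refine ⟨AlgEquiv.ofAlgHom φ ψ ?_ ?_⟩
  · exact (h'.universal C' α' h'.factors).unique
      (fun s => by rw [AlgHom.comp_assoc, hψ, hφ]) (fun s => AlgHom.id_comp _)
  · exact (h.universal C α h.factors).unique
      (fun s => by rw [AlgHom.comp_assoc, hφ, hψ]) (fun s => AlgHom.id_comp _)

/-- A quotient of the tensor power of `A` is universal if its defining ideal is generated by
elements whose vanishing expresses the factorization of the characteristic polynomials. -/
theorem isUniversalFactorization_quotient [DecidableEq S] (I : Ideal (⨂[R] _ : S, A))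
    (hI : ∀ (B : Type u) [CommRing B] [Algebra R B] (φ : (⨂[R] _ : S, A) →ₐ[R] B),
      FactorsCharpoly R R' S A B (fun s => φ.comp
        (PiTensorProduct.singleAlgHom (R := R) (A := fun _ : S => A) s)) ↔
        I ≤ RingHom.ker φ) :
    IsUniversalFactorization R R' S A ((⨂[R] _ : S, A) ⧸ I)
      fun s => (Ideal.Quotient.mkₐ R I).comp
        (PiTensorProduct.singleAlgHom (R := R) (A := fun _ : S => A) s) where
  factors := (hI _ (Ideal.Quotient.mkₐ R I)).2 (Ideal.Quotient.mkₐ_ker R I).ge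
  universal B _ _ β hβ := by
    obtain ⟨φ, hφ⟩ := PiTensorProduct.exists_algHom_comp_single β
    obtain rfl : (fun s => φ.comp
        (PiTensorProduct.singleAlgHom (R := R) (A := fun _ : S => A) s)) = β := funext hφ
    refine ⟨Ideal.Quotient.liftₐ I φ fun a ha => (hI _ φ).1 hβ ha, fun s => rfl, fun ψ hψ => ?_⟩
    refine Ideal.Quotient.algHom_ext R (PiTensorProduct.algHom_ext fun s => ?_)
    exact hψ s

/-- The generators of `galoisClosureIdeal` compare the polynomials coefficient by coefficient for
$a\in A$ only, which is the case $R'=R$. -/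
theorem isUniversalFactorization_galoisClosure (n : ℕ) :
    IsUniversalFactorization R R (Fin n) A (GaloisClosure R A n) fun s =>
      (Ideal.Quotient.mkₐ R (galoisClosureIdeal R A n)).comp
        (PiTensorProduct.singleAlgHom (R := R) (A := fun _ : Fin n => A) s) := by
  refine isUniversalFactorization_quotient _ fun B _ _ φ => ?_
  have h1 (a : A) : (∏ j : Fin n, (Polynomial.X - Polynomial.C
      (PiTensorProduct.singleAlgHom (R := R) (A := fun _ : Fin n => A) j a))).map (φ : _ →+* B) =
      ∏ j, (Polynomial.X - Polynomial.C (φ.comp (PiTensorProduct.singleAlgHom j) a)) := by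
    simp [Polynomial.map_prod]
  have h2 (a : A) : ((elemCharpoly R a).map (algebraMap R (⨂[R] _ : Fin n, A))).map
      (φ : _ →+* B) = (elemCharpoly R a).map (algebraMap R B) := by
    rw [Polynomial.map_map, AlgHom.comp_algebraMap]
  rw [factorsCharpoly_self_iff, galoisClosureIdeal, Ideal.span_le]
  constructor
  · rintro h _ ⟨a, k, rfl⟩
    have := h a
    rw [← h1, ← h2, Polynomial.map_eq_map_iff_coeff] at this
    rw [SetLike.mem_coe, RingHom.mem_ker, map_sub, sub_eq_zero]
    exact (this k).symm
  · intro h a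
    rw [← h1, ← h2, Polynomial.map_eq_map_iff_coeff]
    intro k
    have := h ⟨a, k, rfl⟩
    rw [SetLike.mem_coe, RingHom.mem_ker, map_sub, sub_eq_zero] at this
    exact this.symm

/-- Contraction of the first factor of `R' ⊗ B` with a linear functional on `R'`. -/
noncomputable def tensorContract (l : R' →ₗ[R] R) (B : Type*) [CommRing B] [Algebra R B] :
    R' ⊗[R] B →ₗ[R] B :=
  (TensorProduct.lid R B).toLinearMap ∘ₗ l.rTensor B

theorem tensorContract_map {B B' : Type*} [CommRing B] [Algebra R B] [CommRing B'] [Algebra R B']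
    (l : R' →ₗ[R] R) (φ : B →ₐ[R] B') (x : R' ⊗[R] B) :
    tensorContract l B' (Algebra.TensorProduct.map (AlgHom.id R R') φ x) =
      φ (tensorContract l B x) := by
  induction x with
  | zero => simp
  | add a b ha hb => simp only [map_add, ha, hb]
  | tmul r m => simp [tensorContract]

/-- The contractions with the coordinate functionals of a basis of $R'$ are the coordinates on
$R'\otimes B$. -/
theorem tensorContract_ext [Module.Free R R'] {B : Type*} [CommRing B] [Algebra R B]
    {x y : R' ⊗[R] B} (h : ∀ l : R' →ₗ[R] R, tensorContract l B x = tensorContract l B y) :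
    x = y := by
  let b := Module.Free.chooseBasis R R'
  let e := (TensorProduct.congr b.repr (LinearEquiv.refl R B)).trans
    (TensorProduct.finsuppScalarLeft R B _)
  refine e.injective (Finsupp.ext fun i => ?_)
  have key (x : R' ⊗[R] B) : e x i = tensorContract (b.coord i) B x := by
    induction x with
    | zero => simp
    | add a b ha hb => simp only [map_add, Finsupp.add_apply, ha, hb]
    | tmul r m => simp [tensorContract, e]
  rw [key, key, h]

variable (R R' S A) in
theorem exists_isUniversalFactorization [Module.Free R R'] :
    ∃ (C : Type u) (_ : CommRing C) (_ : Algebra R C) (α : S → A →ₐ[R] C),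
      IsUniversalFactorization R R' S A C α := by
  classical
  let P (a : R' ⊗[R] A) : (R' ⊗[R] (⨂[R] _ : S, A))[X] := ∏ s, (Polynomial.X - Polynomial.C
    (Algebra.TensorProduct.map (AlgHom.id R R')
      (PiTensorProduct.singleAlgHom (R := R) (A := fun _ : S => A) s) a))
  let Q (a : R' ⊗[R] A) : (R' ⊗[R] (⨂[R] _ : S, A))[X] :=
    (elemCharpoly R' a).map (algebraMap R' _)
  -- The equations live in $R'\otimes A^{\otimes S}$. Contracting them with functionals on $R'$
  -- gives elements of $A^{\otimes S}$, and loses nothing because $R'$ is free.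
  let I : Ideal (⨂[R] _ : S, A) := Ideal.span {x | ∃ (a : R' ⊗[R] A) (k : ℕ) (l : R' →ₗ[R] R),
    x = tensorContract l _ ((P a).coeff k) - tensorContract l _ ((Q a).coeff k)}
  refine ⟨_, _, _, _, isUniversalFactorization_quotient I fun B _ _ φ => ?_⟩
  have h1 (a : R' ⊗[R] A) := map_prod_baseChange (R' := R') φ
    (fun s : S => PiTensorProduct.singleAlgHom (R := R) (A := fun _ : S => A) s) a
  have h2 (a : R' ⊗[R] A) := map_algebraMap_baseChange (R := R) φ (elemCharpoly R' a)
  rw [Ideal.span_le]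
  constructor
  · rintro h _ ⟨a, k, l, rfl⟩
    have := h a
    rw [← h1, ← h2, Polynomial.map_eq_map_iff_coeff] at this
    rw [SetLike.mem_coe, RingHom.mem_ker, map_sub, sub_eq_zero, ← tensorContract_map,
      ← tensorContract_map]
    exact congrArg (tensorContract l B) (this k)
  · intro h a
    rw [← h1, ← h2, Polynomial.map_eq_map_iff_coeff]
    refine fun k => tensorContract_ext fun l => ?_
    have := h ⟨a, k, l, rfl⟩
    rw [SetLike.mem_coe, RingHom.mem_ker, map_sub, sub_eq_zero, ← tensorContract_map,
      ← tensorContract_map] at this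
    exact this

theorem existsSClosure {n : ℕ} (hA : HasConstantRank R A n) (hS : Fintype.card S = n) :
    ExistsSClosure R S A := by
  obtain ⟨C, _, _, α, h⟩ := exists_isUniversalFactorization R (MvPolynomial ℕ R) S A
  exact ⟨C, _, _, α, (isSClosure_iff hA hS).2 h⟩

end Universal

/-! ### Counting the maps with prescribed fiber sizes. -/

section Fibers

/-- The maps `f : S → o` whose fiber over `i` has `n i` elements. -/
abbrev FiberType (S o : Type) [Fintype S] [DecidableEq o] (n : o → ℕ) : Type :=
  {f : S → o // ∀ i, Fintype.card {s // f s = i} = n i}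

variable {S o : Type} [Fintype S] [DecidableEq S] [Fintype o] [DecidableEq o] {n : o → ℕ}

omit [DecidableEq S] in
theorem FiberType.nonempty (h : Fintype.card S = ∑ i, n i) : Nonempty (FiberType S o n) := by
  have e : S ≃ Σ i, Fin (n i) := Fintype.equivOfCardEq (by simp [h])
  refine ⟨fun s => (e s).1, fun i => ?_⟩
  obtain ⟨e', -⟩ := Equiv.exists_sigma_fiber (fun i => Fin (n i)) i
  rw [Fintype.card_congr ((e.subtypeEquiv (q := fun a => a.1 = i) fun a => Iff.rfl).trans e'.symm),
    Fintype.card_fin]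

omit [DecidableEq S] [Fintype o] in
theorem FiberType.exists_comp_eq (f g : FiberType S o n) :
    ∃ e : Equiv.Perm S, f.1 ∘ e = g.1 := by
  have σ (i : o) : {s // g.1 s = i} ≃ {s // f.1 s = i} :=
    Fintype.equivOfCardEq ((g.2 i).trans (f.2 i).symm)
  refine ⟨(Equiv.sigmaFiberEquiv g.1).symm.trans
    ((Equiv.sigmaCongrRight σ).trans (Equiv.sigmaFiberEquiv f.1)), funext fun s => ?_⟩
  exact (σ (g.1 s) ⟨s, rfl⟩).2

/-- Orbit and stabilizer: permutations of $S$ act transitively on these maps by precomposition, and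
the stabilizer of $f$ is the product of the symmetric groups of its fibers. -/
theorem FiberType.card_mul (h : Fintype.card S = ∑ i, n i) :
    Fintype.card (FiberType S o n) * ∏ i, (n i).factorial = (Fintype.card S).factorial := by
  classical
  obtain ⟨f⟩ := FiberType.nonempty h
  have h1 : ∏ i, (n i).factorial = Fintype.card {g : Equiv.Perm S // f.1 ∘ g = f.1} := by
    rw [DomMulAct.stabilizer_card]
    exact Finset.prod_congr rfl fun i _ => by rw [f.2]
  have h2 (g : FiberType S o n) : Fintype.card {e : Equiv.Perm S // f.1 ∘ e = g.1} =
      Fintype.card {g : Equiv.Perm S // f.1 ∘ g = f.1} := by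
    obtain ⟨e, he⟩ := FiberType.exists_comp_eq f g
    refine Fintype.card_congr ((Equiv.mulRight e⁻¹).subtypeEquiv fun a => ?_)
    rw [← he, Equiv.coe_mulRight, Equiv.Perm.coe_mul, ← Function.comp_assoc]
    constructor
    · intro h
      rw [h, Function.comp_assoc, ← Equiv.Perm.coe_mul, mul_inv_cancel]
      rfl
    · intro h
      conv_rhs => rw [← h]
      rw [Function.comp_assoc, ← Equiv.Perm.coe_mul, inv_mul_cancel]
      rfl
  have h3 (e : Equiv.Perm S) (i : o) : Fintype.card {s // (f.1 ∘ e) s = i} = n i := by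
    rw [← f.2 i]
    exact Fintype.card_congr (e.subtypeEquiv fun a => Iff.rfl)
  -- By `h2`, all fibers of this orbit map have the size of the stabilizer.
  let F (e : Equiv.Perm S) : FiberType S o n := ⟨f.1 ∘ e, h3 e⟩
  rw [← Fintype.card_perm, ← Fintype.card_congr (Equiv.sigmaFiberEquiv F), Fintype.card_sigma, h1,
    ← smul_eq_mul, ← Finset.card_univ, ← Finset.sum_const]
  refine Finset.sum_congr rfl fun g _ => ?_
  rw [← h2 g]
  exact Fintype.card_congr (Equiv.subtypeEquivRight fun e =>
    (Subtype.ext_iff (a1 := F e) (a2 := g)).symm)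

theorem FiberType.card (h : Fintype.card S = ∑ i, n i) :
    Fintype.card (FiberType S o n) = (∑ i, n i).factorial / ∏ i, (n i).factorial := by
  rw [← h, ← FiberType.card_mul h, Nat.mul_div_cancel _
    (Finset.prod_pos fun i _ => Nat.factorial_pos _)]

end Fibers

/-! ### Maps $\alpha_s$ that factor through a prescribed factor $A_{f(s)}$. -/

section Local

/-- If $\varphi(e_i)=1$ then $\varphi(a)=\varphi(ae_i)$ depends only on the $i$-th component of $a$.
-/
theorem AlgHom.exists_comp_eval {R o B : Type*} [CommRing R] [DecidableEq o]
    {A : o → Type*} [∀ i, CommRing (A i)] [∀ i, Algebra R (A i)] [CommRing B] [Algebra R B]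
    (φ : (∀ i, A i) →ₐ[R] B) (i : o) (h : φ (Pi.single i 1) = 1) :
    ∃ γ : A i →ₐ[R] B, γ.comp (Pi.evalAlgHom R A i) = φ := by
  refine ⟨AlgHom.ofLinearMap (φ.toLinearMap ∘ₗ LinearMap.single R A i) h fun x y => ?_, ?_⟩
  · simp [Pi.single_mul]
  · ext a
    have : (Pi.single i (a i) : ∀ i, A i) = a * Pi.single i 1 := by
      rw [← Pi.single_mul_right, mul_one]
    change φ (Pi.single i (a i)) = φ a
    rw [this, map_mul, h, mul_one]

variable {R R' : Type u} {S o : Type} [Fintype S] [Fintype o] [LinearOrder o] {A : o → Type u}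
  {B : Type u} [CommRing R] [CommRing R'] [Algebra R R'] [∀ i, CommRing (A i)]
  [∀ i, Algebra R (A i)] [CommRing B] [Algebra R B] [∀ i, Module.Finite R (A i)]
  [∀ i, Module.Projective R (A i)]

theorem FactorsCharpoly.reindex {S' : Type} [Fintype S'] {A : Type u} [CommRing A] [Algebra R A]
    [Module.Finite R A] [Module.Projective R A] {β : S → A →ₐ[R] B}
    (h : FactorsCharpoly R R' S A B β) (e : S' ≃ S) :
    FactorsCharpoly R R' S' A B fun s => β (e s) := fun a => by
  rw [← h a, ← e.prod_comp]

/-- The maps `∏ i, A i → A (f s) → B` assembled from maps on the factors. -/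
def assemble (f : S → o) (γ : ∀ i, {s // f s = i} → A i →ₐ[R] B) (s : S) :
    (∀ i, A i) →ₐ[R] B :=
  (γ (f s) ⟨s, rfl⟩).comp (Pi.evalAlgHom R A (f s))

omit [Fintype S] [Fintype o] [LinearOrder o] [∀ i, Module.Finite R (A i)]
  [∀ i, Module.Projective R (A i)] in
theorem assemble_of_mem (f : S → o) (γ : ∀ i, {s // f s = i} → A i →ₐ[R] B) {i : o}
    (s : {s // f s = i}) :
    assemble f γ s = (γ i s).comp (Pi.evalAlgHom R A i) := by
  obtain ⟨s, rfl⟩ := s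
  rfl

omit [∀ i, Module.Finite R (A i)] [∀ i, Module.Projective R (A i)] in
theorem prod_assemble (f : S → o) (γ : ∀ i, {s // f s = i} → A i →ₐ[R] B)
    (a : R' ⊗[R] (∀ i, A i)) :
    (∏ s, (Polynomial.X - Polynomial.C
      (Algebra.TensorProduct.map (AlgHom.id R R') (assemble f γ s) a)) : (R' ⊗[R] B)[X]) =
    ∏ i, ∏ s : {s // f s = i}, (Polynomial.X - Polynomial.C (Algebra.TensorProduct.map
      (AlgHom.id R R') (γ i s)
        (Algebra.TensorProduct.map (AlgHom.id R R') (Pi.evalAlgHom R A i) a))) := by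
  rw [← (Equiv.sigmaFiberEquiv f).prod_comp, Fintype.prod_sigma]
  refine Finset.prod_congr rfl fun i _ => Finset.prod_congr rfl fun s _ => ?_
  change Polynomial.X - Polynomial.C (Algebra.TensorProduct.map (AlgHom.id R R')
    (assemble f γ s) a) = _
  rw [assemble_of_mem, Algebra.TensorProduct.map_id_comp]
  rfl

theorem FactorsCharpoly.assemble {f : S → o} {γ : ∀ i, {s // f s = i} → A i →ₐ[R] B}
    (h : ∀ i, FactorsCharpoly R R' {s // f s = i} (A i) B (γ i)) :
    FactorsCharpoly R R' S (∀ i, A i) B (assemble f γ) := fun a => by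
  rw [prod_assemble, elemCharpoly_pi, Polynomial.map_prod]
  exact Finset.prod_congr rfl fun i _ => h i _

/-- Extend $a\in R'\otimes A_i$ by zero to the product. Each factor $j\ne i$ then contributes
$X^{n_j}$ to both sides, on the left because of the fiber sizes, and these monic factors cancel. -/
theorem FactorsCharpoly.of_assemble {n : o → ℕ} (hA : ∀ i, HasConstantRank R (A i) (n i))
    {f : S → o} (hf : ∀ i, Fintype.card {s // f s = i} = n i)
    {γ : ∀ i, {s // f s = i} → A i →ₐ[R] B}
    (h : FactorsCharpoly R R' S (∀ i, A i) B (_root_.assemble f γ)) (i : o) :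
    FactorsCharpoly R R' {s // f s = i} (A i) B (γ i) := fun a => by
  obtain ⟨b, hb, hb'⟩ : ∃ b : R' ⊗[R] (∀ i, A i),
      Algebra.TensorProduct.map (AlgHom.id R R') (Pi.evalAlgHom R A i) b = a ∧ ∀ j ≠ i,
      Algebra.TensorProduct.map (AlgHom.id R R') (Pi.evalAlgHom R A j) b = 0 := by
    refine ⟨(LinearMap.single R A i).lTensor R' a, ?_, fun j hj => ?_⟩
    · induction a with
      | zero => simp
      | add a b ha hb => simp only [map_add, ha, hb]
      | tmul r m => simp
    · induction a with
      | zero => simp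
      | add a b ha hb => simp only [map_add, ha, hb, add_zero]
      | tmul r m => simp [Pi.single_eq_of_ne hj]
  have key := h b
  rw [prod_assemble, elemCharpoly_pi, Polynomial.map_prod, Fintype.prod_eq_mul_prod_compl i,
    Fintype.prod_eq_mul_prod_compl i, hb, Finset.prod_congr rfl (g := fun j => Polynomial.X ^ n j),
    Finset.prod_congr (s₁ := {i}ᶜ) rfl (f := fun j => Polynomial.map _ _)
      (g := fun j => Polynomial.X ^ n j)] at key
  · exact (Polynomial.monic_prod_of_monic _ _ fun j _ =>
      Polynomial.monic_X_pow (n j)).isRegular.right key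
  · intro j hj
    rw [hb' j (by simpa using hj), elemCharpoly_zero ((hA j).baseChange R'), Polynomial.map_pow,
      Polynomial.map_X]
  · intro j hj
    rw [hb' j (by simpa using hj)]
    simp [hf]

theorem elemCharpoly_single_one {n : o → ℕ} (hA : ∀ i, HasConstantRank R (A i) (n i)) (i : o) :
    elemCharpoly R (Pi.single i 1 : ∀ i, A i) =
      (Polynomial.X - 1) ^ n i * Polynomial.X ^ ∑ j ∈ {i}ᶜ, n j := by
  have h := elemCharpoly_tmul (R := R) R (Pi.single i 1 : ∀ i, A i)
  rw [Algebra.algebraMap_self, Polynomial.map_id] at h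
  rw [← h, elemCharpoly_pi, Fintype.prod_eq_mul_prod_compl i, ← Finset.prod_pow_eq_pow_sum]
  congr 1
  · simp only [Algebra.TensorProduct.map_tmul, AlgHom.id_apply, Pi.evalAlgHom_apply,
      Pi.single_eq_same]
    exact elemCharpoly_one ((hA i).baseChange R)
  · refine Finset.prod_congr rfl fun j hj => ?_
    simp only [Algebra.TensorProduct.map_tmul, AlgHom.id_apply, Pi.evalAlgHom_apply,
      Pi.single_eq_of_ne (show j ≠ i by simpa using hj), TensorProduct.tmul_zero]
    exact elemCharpoly_zero ((hA j).baseChange R)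

theorem Polynomial.rootMultiplicity_one_mul_X_pow {K : Type*} [Field K] (c d : ℕ) :
    ((Polynomial.X - 1) ^ c * Polynomial.X ^ d : K[X]).rootMultiplicity 1 = c := by
  rw [← Polynomial.C_1, Polynomial.rootMultiplicity_mul
    ((Polynomial.monic_X_sub_C _).pow c |>.mul (Polynomial.monic_X_pow d)).ne_zero,
    Polynomial.rootMultiplicity_X_sub_C_pow, Polynomial.rootMultiplicity_eq_zero (by simp),
    add_zero]

/-- Both exponents of $X-1$ are read off from the factorization for $a=e_i$: it gives $n_i$ in the
characteristic polynomial, and the number of $s$ with $\alpha_s(e_i)=1$ in the product. -/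
theorem FactorsCharpoly.card_fiber [Nontrivial B] {n : o → ℕ}
    (hA : ∀ i, HasConstantRank R (A i) (n i)) {α : S → (∀ i, A i) →ₐ[R] B}
    (h : FactorsCharpoly R R S (∀ i, A i) B α) {f : S → o}
    (hf : ∀ s, α s (Pi.single (f s) 1) = 1) (i : o) : Fintype.card {s // f s = i} = n i := by
  classical
  have h1 (s : S) : α s (Pi.single i 1) = if f s = i then 1 else 0 := by
    split_ifs with hs
    · rw [← hs, hf]
    · have : (Pi.single i 1 * Pi.single (f s) 1 : ∀ i, A i) = 0 := by
        rw [← Pi.single_mul_left, Pi.single_eq_of_ne (Ne.symm hs), mul_zero, Pi.single_zero]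
      rw [← mul_one (α s _), ← hf s, ← map_mul, this, map_zero]
  -- Over a residue field of $B$, the exponent is the multiplicity of the root $1$.
  obtain ⟨J, hJ⟩ := Ideal.exists_maximal B
  let := Ideal.Quotient.field J
  have h2 := congrArg (Polynomial.map (Ideal.Quotient.mk J))
    (factorsCharpoly_self_iff.1 h (Pi.single i 1))
  have h3 : (∏ s, (Polynomial.X - Polynomial.C (α s (Pi.single i 1)))).map
      (Ideal.Quotient.mk J) = (Polynomial.X - 1) ^ (Fintype.card {s // f s = i}) *
        Polynomial.X ^ (Fintype.card {s // ¬ f s = i}) := by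
    rw [Polynomial.map_prod, Fintype.card_subtype, Fintype.card_subtype, ← Finset.prod_const,
      ← Finset.prod_const, ← Finset.prod_ite]
    refine Finset.prod_congr rfl fun s _ => ?_
    rw [h1]
    split_ifs <;> simp
  rw [h3, elemCharpoly_single_one hA] at h2
  simp only [Polynomial.map_mul, Polynomial.map_pow, Polynomial.map_sub, Polynomial.map_X,
    Polynomial.map_one] at h2
  rw [← Polynomial.rootMultiplicity_one_mul_X_pow (K := B ⧸ J) (n i), ← h2,
    Polynomial.rootMultiplicity_one_mul_X_pow]

end Local

/-! ### Splitting the target ring by idempotents. -/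

section Idempotents

variable {R : Type*} {S o : Type*} [Fintype S] [Fintype o] [DecidableEq o]
  {A : o → Type*} {B : Type*} [CommRing R] [∀ i, CommRing (A i)]
  [∀ i, Algebra R (A i)] [CommRing B] [Algebra R B]

/-- The idempotent of `B` on whose component the map `α s` factors through `A (f s)`. -/
def fiberIdempotent (α : S → (∀ i, A i) →ₐ[R] B) (f : S → o) : B :=
  ∏ s, α s (Pi.single (f s) 1)

/-- If $f(s)\ne g(s)$, the factors at $s$ multiply to $\alpha_s(e_{f(s)}e_{g(s)})=0$. The sum over
all $f$ is the expansion of $\prod_s\sum_i\alpha_s(e_i)=1$. -/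
theorem completeOrthogonalIdempotents_fiberIdempotent [DecidableEq S]
    (α : S → (∀ i, A i) →ₐ[R] B) : CompleteOrthogonalIdempotents (fiberIdempotent α) := by
  rw [CompleteOrthogonalIdempotents.iff_ortho_complete]
  constructor
  · intro f g hfg
    obtain ⟨s, hs⟩ := Function.ne_iff.1 hfg
    rw [fiberIdempotent, fiberIdempotent, ← Finset.prod_mul_distrib]
    refine Finset.prod_eq_zero (Finset.mem_univ s) ?_
    rw [← map_mul, ← Pi.single_mul_left, Pi.single_eq_of_ne hs, mul_zero, Pi.single_zero, map_zero]
  · have h := Finset.prod_univ_sum (fun _ : S => (Finset.univ : Finset o))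
      fun s i => α s (Pi.single i 1)
    rw [Fintype.piFinset_univ] at h
    refine h.symm.trans (Finset.prod_eq_one fun s _ => ?_)
    rw [← map_sum, Finset.univ_sum_single (M := A) (fun _ => 1)]
    exact map_one _

omit [Fintype o] in
theorem map_fiberIdempotent {B' : Type*} [CommRing B'] [Algebra R B']
    (α : S → (∀ i, A i) →ₐ[R] B) (f : S → o) (φ : B →ₐ[R] B') :
    φ (fiberIdempotent α f) = fiberIdempotent (fun s => φ.comp (α s)) f :=
  map_prod φ _ _

omit [Fintype o] in
theorem map_single_eq_one {B' : Type*} [CommRing B'] [Algebra R B']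
    {α : S → (∀ i, A i) →ₐ[R] B} {f : S → o} (φ : B →ₐ[R] B') (h : φ (fiberIdempotent α f) = 1)
    (s : S) : φ (α s (Pi.single (f s) 1)) = 1 := by
  have h1 : fiberIdempotent α f * α s (Pi.single (f s) 1) = fiberIdempotent α f := by
    classical
    rw [fiberIdempotent, ← Finset.mul_prod_erase _ _ (Finset.mem_univ s), mul_right_comm,
      ← map_mul, ← Pi.single_mul_left, Pi.single_eq_same, mul_one]
  have h2 := congrArg φ h1
  rwa [map_mul, h, one_mul] at h2

end Idempotents

/-- Covers the components of $B$ that vanish because $f$ has the wrong fiber sizes. -/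
theorem AlgHom.existsUnique_of_subsingleton {R C B : Type*} [CommRing R] [CommRing C] [CommRing B]
    [Algebra R C] [Algebra R B] [Subsingleton B] (p : (C →ₐ[R] B) → Prop) (hp : ∀ φ, p φ) :
    ∃! φ, p φ :=
  ⟨AlgHom.ofLinearMap 0 (Subsingleton.elim _ _) fun _ _ => Subsingleton.elim _ _, hp _,
    fun _ _ => AlgHom.ext fun _ => Subsingleton.elim _ _⟩

/-- A complete family of orthogonal idempotents decomposes `B` as a product of quotients, so that
a unique map to `B` with prescribed composites exists if one exists for each of the quotients. -/
theorem CompleteOrthogonalIdempotents.existsUnique_algHom {R C B ι T : Type*} {A : T → Type*}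
    [CommRing R] [CommRing C] [CommRing B] [Algebra R C] [Algebra R B] [Fintype ι]
    [∀ t, CommRing (A t)] [∀ t, Algebra R (A t)] {e : ι → B}
    (he : CompleteOrthogonalIdempotents e) (α : ∀ t, A t →ₐ[R] C) (β : ∀ t, A t →ₐ[R] B)
    (h : ∀ i, ∃! φ : C →ₐ[R] B ⧸ Ideal.span {1 - e i},
      ∀ t, φ.comp (α t) = (Ideal.Quotient.mkₐ R _).comp (β t)) :
    ∃! φ : C →ₐ[R] B, ∀ t, φ.comp (α t) = β t := by
  choose ψ hψ hψ' using h
  let q : B →ₐ[R] ∀ i, B ⧸ Ideal.span {1 - e i} :=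
    AlgHom.pi fun i => Ideal.Quotient.mkₐ R (Ideal.span {1 - e i})
  have hq : Function.Bijective q := he.bijective_pi
  let Q := AlgEquiv.ofBijective q hq
  have hQ (x) : q (Q.symm x) = x := Q.apply_symm_apply x
  refine ⟨Q.symm.toAlgHom.comp (AlgHom.pi ψ), fun t => AlgHom.ext fun a => hq.1 ?_,
    fun φ hφ => AlgHom.ext fun c => hq.1 ?_⟩
  · refine (hQ _).trans (funext fun i => ?_)
    exact AlgHom.congr_fun (hψ i t) a
  · refine Eq.trans (funext fun i => ?_) (hQ _).symm
    refine AlgHom.congr_fun (hψ' i ((Ideal.Quotient.mkₐ R _).comp φ) fun t => ?_) c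
    rw [AlgHom.comp_assoc, hφ]

/-! ### The universal factorization of a product of algebras. -/

section Product

variable {R R' : Type u} {S o : Type} [Fintype S] [DecidableEq S] [Fintype o] [LinearOrder o]
  {A : o → Type u} [CommRing R] [CommRing R'] [Algebra R R'] [∀ i, CommRing (A i)]
  [∀ i, Algebra R (A i)] [∀ i, Module.Finite R (A i)]
  [∀ i, Module.Projective R (A i)] {n : o → ℕ}
  {D : o → Type u} [∀ i, CommRing (D i)] [∀ i, Algebra R (D i)]

/-- The maps to the tensor product of the `D i` attached to `f : S → o` and identifications of
the fibers of `f` with the index sets of the maps `A i → D i`. -/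
noncomputable def tensorMaps (β : ∀ i, Fin (n i) → A i →ₐ[R] D i) (f : S → o)
    (σ : ∀ i, {s // f s = i} ≃ Fin (n i)) (i : o) (s : {s // f s = i}) :
    A i →ₐ[R] ⨂[R] i, D i :=
  (PiTensorProduct.singleAlgHom i).comp (β i (σ i s))

omit [DecidableEq S] in
-- For fixed $f$, the $\alpha_s$ amount to one factorization for each $A_i$, hence to one map
-- $D_i\to B$ for each $i$, hence to one map from the tensor product.
theorem existsUnique_of_map_single {β : ∀ i, Fin (n i) → A i →ₐ[R] D i}
    (hA : ∀ i, HasConstantRank R (A i) (n i))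
    (hβ : ∀ i, IsUniversalFactorization R R' (Fin (n i)) (A i) (D i) (β i)) {f : S → o}
    (σ : ∀ i, {s // f s = i} ≃ Fin (n i)) {B : Type u} [CommRing B] [Algebra R B]
    {α : S → (∀ i, A i) →ₐ[R] B} (hα : FactorsCharpoly R R' S (∀ i, A i) B α)
    (h1 : ∀ s, α s (Pi.single (f s) 1) = 1) :
    ∃! φ : (⨂[R] i, D i) →ₐ[R] B, ∀ s, φ.comp (assemble f (tensorMaps β f σ) s) = α s := by
  have hγ (i : o) (s : {s // f s = i}) : ∃ γ : A i →ₐ[R] B,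
      γ.comp (Pi.evalAlgHom R A i) = α s := by
    obtain ⟨s, rfl⟩ := s
    exact AlgHom.exists_comp_eval _ _ (h1 s)
  choose γ hγ using hγ
  obtain rfl : assemble f γ = α := funext fun s => hγ _ ⟨s, rfl⟩
  have hev (i : o) : Function.Surjective (Pi.evalAlgHom R A i) := fun x =>
    ⟨Pi.single i x, by simp⟩
  have hfac (i : o) : FactorsCharpoly R R' (Fin (n i)) (A i) B fun k => γ i ((σ i).symm k) :=
    (hα.of_assemble hA (fun i => by rw [Fintype.card_congr (σ i), Fintype.card_fin]) i).reindex
      (σ i).symm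
  have key (φ : (⨂[R] i, D i) →ₐ[R] B) :
      (∀ s, φ.comp (assemble f (tensorMaps β f σ) s) = assemble f γ s) ↔
      ∀ i k, (φ.comp (PiTensorProduct.singleAlgHom i)).comp (β i k) = γ i ((σ i).symm k) := by
    constructor
    · intro h i k
      have := h ((σ i).symm k)
      rw [assemble_of_mem, assemble_of_mem, ← AlgHom.comp_assoc,
        AlgHom.cancel_right (hev i), tensorMaps, Equiv.apply_symm_apply] at this
      rw [AlgHom.comp_assoc, this]
    · intro h s
      have := h (f s) (σ (f s) ⟨s, rfl⟩)
      rw [Equiv.symm_apply_apply, AlgHom.comp_assoc] at this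
      rw [assemble, assemble, ← AlgHom.comp_assoc, tensorMaps, this]
  simp only [key]
  choose ψ hψ hψ' using fun i => (hβ i).universal B _ (hfac i)
  obtain ⟨φ, hφ⟩ := PiTensorProduct.exists_algHom_comp_single ψ
  refine ⟨φ, fun i k => by rw [hφ, hψ], fun φ' hφ' => PiTensorProduct.algHom_ext fun i => ?_⟩
  rw [hφ]
  exact hψ' i _ (hφ' i)

/-- A product indexed by the maps `f : S → o` with prescribed fibers is universal if its factors
are universal among the algebras on which `α s` factors through `A (f s)`. -/
theorem isUniversalFactorization_pi (π : R' →ₐ[R] R)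
    (hA : ∀ i, HasConstantRank R (A i) (n i)) {E : Type u} [CommRing E] [Algebra R E]
    (τ : FiberType S o n → S → (∀ i, A i) →ₐ[R] E)
    (hτ : ∀ f s i, τ f s (Pi.single i 1) = if f.1 s = i then 1 else 0)
    (hfac : ∀ f, FactorsCharpoly R R' S (∀ i, A i) E (τ f))
    (huniv : ∀ f (B : Type u) [CommRing B] [Algebra R B] (α : S → (∀ i, A i) →ₐ[R] B),
      FactorsCharpoly R R' S (∀ i, A i) B α → (∀ s, α s (Pi.single (f.1 s) 1) = 1) →
      ∃! φ : E →ₐ[R] B, ∀ s, φ.comp (τ f s) = α s) :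
    IsUniversalFactorization R R' S (∀ i, A i) (FiberType S o n → E)
      fun s => AlgHom.pi fun f => τ f s where
  factors := FactorsCharpoly.pi hfac
  universal B _ _ α' hα' := by
    -- In the candidate ring the idempotent of $f$ is the unit vector of the coordinate $f$, because
    -- $\tau_g$ sends $e_{f(s)}$ to $0$ at any $s$ where $g$ and $f$ differ.
    have hα (f : FiberType S o n) : fiberIdempotent
        (fun s => (AlgHom.pi fun f => τ f s : (∀ i, A i) →ₐ[R] (FiberType S o n → E))) f.1 =
          Pi.single f 1 := by
      ext g
      have h1 : fiberIdempotent (fun s =>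
          (AlgHom.pi fun f => τ f s : (∀ i, A i) →ₐ[R] (FiberType S o n → E))) f.1 g =
            ∏ s, τ g s (Pi.single (f.1 s) 1) := by
        rw [fiberIdempotent, Finset.prod_apply]
        rfl
      rw [h1]
      simp only [hτ]
      obtain rfl | hfg := eq_or_ne g f
      · simp
      · obtain ⟨s, hs⟩ := Function.ne_iff.1 (fun h => hfg (Subtype.ext h))
        rw [Pi.single_eq_of_ne hfg]
        exact Finset.prod_eq_zero (Finset.mem_univ s) (if_neg hs)
    refine (completeOrthogonalIdempotents_fiberIdempotent α').existsUnique_algHom _ α' fun f => ?_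
    set q := Ideal.Quotient.mkₐ R (Ideal.span {1 - fiberIdempotent α' f})
    have hq : q (fiberIdempotent α' f) = 1 := by
      have : q (1 - fiberIdempotent α' f) = 0 :=
        Ideal.Quotient.eq_zero_iff_mem.2 (Ideal.mem_span_singleton_self _)
      rwa [map_sub, map_one, sub_eq_zero, eq_comm] at this
    have h1 := map_single_eq_one q hq
    have h2 := hα'.comp q
    cases subsingleton_or_nontrivial (B ⧸ Ideal.span {1 - fiberIdempotent α' f}) with
    | inl h =>
      exact AlgHom.existsUnique_of_subsingleton _ fun φ s =>
        AlgHom.ext fun a => Subsingleton.elim _ _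
    | inr h =>
      -- On a nonzero component the fiber sizes are forced, so $f$ indexes a coordinate of the
      -- candidate ring. The retraction $\pi$ brings the factorization down to $R$, where the sizes
      -- are computed.
      obtain ⟨f, rfl⟩ : ∃ f' : FiberType S o n, f'.1 = f :=
        ⟨⟨f, (h2.of_algHom π).card_fiber hA h1⟩, rfl⟩
      obtain ⟨φ, hφ, hφ'⟩ := huniv f _ _ h2 h1
      refine ⟨φ.comp (Pi.evalAlgHom R _ f), fun s => hφ s, fun ψ hψ => ?_⟩
      -- Any competing map sends the unit vector of $f$ to the image of the idempotent of $f$ in the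
      -- quotient, which is $1$, so it factors through the coordinate $f$.
      obtain ⟨ψ, rfl⟩ := ψ.exists_comp_eval f (by
        rw [← hα, ← hq, map_fiberIdempotent, map_fiberIdempotent]
        exact congrArg (fiberIdempotent · f.1) (funext hψ))
      rw [hφ' ψ fun s => hψ s]

theorem IsUniversalFactorization.exists_pi (π : R' →ₐ[R] R)
    {β : ∀ i, Fin (n i) → A i →ₐ[R] D i} (hA : ∀ i, HasConstantRank R (A i) (n i))
    (hβ : ∀ i, IsUniversalFactorization R R' (Fin (n i)) (A i) (D i) (β i)) :
    ∃ α : S → (∀ i, A i) →ₐ[R] (FiberType S o n → ⨂[R] i, D i),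
      IsUniversalFactorization R R' S (∀ i, A i) (FiberType S o n → ⨂[R] i, D i) α := by
  -- Any labelling of the fibers will do: the product over a fiber does not depend on it.
  have σ (f : FiberType S o n) (i : o) : {s // f.1 s = i} ≃ Fin (n i) :=
    Fintype.equivOfCardEq ((f.2 i).trans (Fintype.card_fin _).symm)
  refine ⟨_, isUniversalFactorization_pi π hA
    (fun f => assemble f.1 (tensorMaps β f.1 (σ f))) (fun f s i => ?_)
    (fun f => FactorsCharpoly.assemble fun i => ((hβ i).factors.comp _).reindex (σ f i))
    fun f B _ _ α hα h1 => existsUnique_of_map_single hA hβ (σ f) hα h1⟩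
  simp only [assemble, AlgHom.comp_apply, Pi.evalAlgHom_apply]
  split_ifs with h
  · subst h
    rw [Pi.single_eq_same, map_one]
  · rw [Pi.single_eq_of_ne h, map_zero]

/-- A universal factorization of the product is the product of copies of the tensor product of
universal factorizations of the factors. -/
theorem IsUniversalFactorization.nonempty_algEquiv_pi (π : R' →ₐ[R] R)
    {β : ∀ i, Fin (n i) → A i →ₐ[R] D i} (hA : ∀ i, HasConstantRank R (A i) (n i))
    (hβ : ∀ i, IsUniversalFactorization R R' (Fin (n i)) (A i) (D i) (β i))
    (hS : Fintype.card S = ∑ i, n i) {C : Type u} [CommRing C] [Algebra R C]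
    {α : S → (∀ i, A i) →ₐ[R] C} (hα : IsUniversalFactorization R R' S (∀ i, A i) C α) :
    Nonempty (C ≃ₐ[R]
      (Fin ((∑ i, n i).factorial / ∏ i, (n i).factorial) → ⨂[R] i, D i)) := by
  obtain ⟨α', hα'⟩ := IsUniversalFactorization.exists_pi (S := S) π hA hβ
  obtain ⟨e⟩ := hα.nonempty_algEquiv hα'
  have e' : FiberType S o n ≃ Fin ((∑ i, n i).factorial / ∏ i, (n i).factorial) :=
    Fintype.equivOfCardEq (by rw [FiberType.card hS, Fintype.card_fin])
  exact ⟨e.trans (AlgEquiv.piCongrLeft R (fun _ => ⨂[R] i, D i) e')⟩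

end Product

theorem mainTheorem8 (R : Type u) [CommRing R] (m : ℕ) (n : Fin m → ℕ)
    (A : Fin m → Type u) [∀ i, CommRing (A i)] [∀ i, Algebra R (A i)]
    [∀ i, Module.Finite R (A i)] [∀ i, Module.Projective R (A i)]
    (hA : ∀ i, HasConstantRank R (A i) (n i)) :
    -- the product is an algebra of rank `∑ i, n i`
    HasConstantRank R (∀ i, A i) (∑ i, n i) ∧
    -- the closures in question exist
    (∀ i, ExistsSClosure R (Fin (n i)) (A i)) ∧
    ExistsSClosure R (Fin (∑ i, n i)) (∀ i, A i) ∧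
    -- the product formula for the closures
    (∀ (C : Type u) [CommRing C] [Algebra R C]
      (α : Fin (∑ i, n i) → (∀ i, A i) →ₐ[R] C)
      (D : Fin m → Type u) [∀ i, CommRing (D i)] [∀ i, Algebra R (D i)]
      (β : ∀ i, Fin (n i) → A i →ₐ[R] D i),
      IsSClosure R (Fin (∑ i, n i)) (∀ i, A i) C α →
      (∀ i, IsSClosure R (Fin (n i)) (A i) (D i) (β i)) →
      Nonempty (C ≃ₐ[R]
        (Fin ((∑ i, n i).factorial / ∏ i, (n i).factorial) → ⨂[R] i, D i))) ∧
    -- the same formula for the Galois closures of Bhargava and Satriano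
    Nonempty (GaloisClosure R (∀ i, A i) (∑ i, n i) ≃ₐ[R]
      (Fin ((∑ i, n i).factorial / ∏ i, (n i).factorial) →
        ⨂[R] i, GaloisClosure R (A i) (n i))) := by
  have hP : HasConstantRank R (∀ i, A i) (∑ i, n i) := HasConstantRank.pi hA
  refine ⟨hP, fun i => existsSClosure (hA i) (Fintype.card_fin _),
    existsSClosure hP (Fintype.card_fin _),
    fun C _ _ α D _ _ β hα hβ => ?_, ?_⟩
  · have h1 i := (isSClosure_iff (hA i) (Fintype.card_fin _)).1 (hβ i)
    have h2 := (isSClosure_iff hP (Fintype.card_fin _)).1 hα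
    -- Any retraction would serve; this one sets all variables to zero.
    have π : MvPolynomial ℕ R →ₐ[R] R := MvPolynomial.aeval fun _ => 0
    exact IsUniversalFactorization.nonempty_algEquiv_pi π hA h1 (Fintype.card_fin _) h2
  · have h1 i := isUniversalFactorization_galoisClosure (R := R) (A := A i) (n i)
    have h2 := isUniversalFactorization_galoisClosure (R := R) (A := ∀ i, A i) (∑ i, n i)
    have h3 := IsUniversalFactorization.nonempty_algEquiv_pi
      (D := fun i => GaloisClosure R (A i) (n i)) (AlgHom.id R R) hA h1 (Fintype.card_fin _) h2
    exact h3
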